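/- Let $m,r\in\mathbb N$, $L^2=L^2((0,\pi),\mathbb R^m)$, $L^\infty_r=L^\infty((0,\pi),\mathbb R^r)$, and let $|\cdot|$ be the Euclidean norm on vectors and the operator norm on matrices. For $\beta>0$ let $D((-\Delta)^\beta)$ be the set of all $$x=\sum_{j\ge1}a_j\sqrt{\tfrac2\pi}\,\sin jt\in L^2,\qquad a_j=\int_0^\pi\sqrt{\tfrac2\pi}\,\sin(jt)\,x(t)\,dt\in\mathbb R^m,$$ with $\sum_{j\ge1}\big((j^2)^{\beta}\big)^2|a_j|^2<\infty$; put $$(-\Delta)^\beta x=\sum_{j\ge1}(j^2)^\beta a_j\sqrt{\tfrac2\pi}\,\sin jt\in L^2$$ (the fractional Dirichlet–Laplace operator on $(0,\pi)$), and equip $D((-\Delta)^\beta)$ with the norm $\|x\|_{\sim\beta}=\|(-\Delta)^\beta x\|_{L^2}$. Let $\beta>\frac12$ and let $f:(0,\pi)\times\mathbb R^m\times\mathbb R^r\to\mathbb R^m$ be measurable in $t$ for every $(x,u)$ and continuously differentiable in $(x,u)$ for every $t$. Assume that there are $a,b\in L^2((0,\pi),\mathbb R)$ and continuous functions $\gamma,\delta:[0,\infty)\to[0,\infty)$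 such that, for all $(t,x,u)\in(0,\pi)\times\mathbb R^m\times\mathbb R^r$, $$|f(t,x,u)|\le a(t)|x|+b(t)\delta(|u|),\qquad |f_x(t,x,u)|\le a(t)\gamma(|x|)+b(t)\delta(|u|),$$ and that $$\sqrt{\tfrac2\pi\,\zeta(4\beta)}\;\|a\|_{L^2}<1,$$ where $\zeta$ is the Riemann zeta function. Then, for every fixed $u\in L^\infty_r$, the function $F(x,u)=(-\Delta)^\beta x-f(\cdot,x(\cdot),u(\cdot))$ belongs to $L^2$ for every $x\in D((-\Delta)^\beta)$, and the functional $$\varphi:D((-\Delta)^\beta)\to\mathbb R,\qquad \varphi(x)=\tfrac12\|F(x,u)\|_{L^2}^2,$$ is of class $C^1$ and satisfies the Palais–Smale condition: every sequence $(x_k)$ in $D((-\Delta)^\beta)$ such that $(\varphi(x_k))$ is bounded and $\varphi'(x_k)\to0$ in the dual space has a subsequence that converges in $D((-\Delta)^\beta)$. -/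

import Mathlib

open MeasureTheory Set Filter Topology
open scoped NNReal ENNReal

noncomputable section

namespace DirichletLaplace

/-- Euclidean space `ℝ^m`. -/
abbrev Euc (m : ℕ) : Type := EuclideanSpace ℝ (Fin m)

/-- Lebesgue measure on the interval `(0, π)`. -/
abbrev leb : Measure ℝ := volume.restrict (Ioo 0 Real.pi)

/-- The real Hilbert space `L² = L²((0, π), ℝ^m)`. -/
abbrev L2 (m : ℕ) : Type := Lp (Euc m) 2 leb

/-- The space `L^∞((0, π), ℝ^r)`. -/
abbrev LInf (r : ℕ) : Type := Lp (Euc r) ∞ leb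

/-! ### The sine system

The index `j : ℕ` stands for the positive integer `j + 1`. -/

/-- The function `√(2/π) sin ((j+1) t)`. -/
def sineFn (j : ℕ) (t : ℝ) : ℝ := Real.sqrt (2 / Real.pi) * Real.sin (((j : ℝ) + 1) * t)

theorem continuous_sineFn (j : ℕ) : Continuous (sineFn j) := by
  unfold sineFn; fun_prop

theorem abs_sineFn_le (j : ℕ) (t : ℝ) : |sineFn j t| ≤ Real.sqrt (2 / Real.pi) := by
  unfold sineFn
  rw [abs_mul, abs_of_nonneg (Real.sqrt_nonneg _)]
  exact mul_le_of_le_one_right (Real.sqrt_nonneg _) (Real.abs_sin_le_one _)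

theorem memLp_sineMode {m : ℕ} (j : ℕ) (c : Euc m) :
    MemLp (fun t => sineFn j t • c) 2 leb := by
  refine MemLp.of_bound
    ((continuous_sineFn j).smul continuous_const).aestronglyMeasurable
    (Real.sqrt (2 / Real.pi) * ‖c‖) (Eventually.of_forall fun t => ?_)
  rw [norm_smul, Real.norm_eq_abs]
  exact mul_le_mul_of_nonneg_right (abs_sineFn_le j t) (norm_nonneg _)

/-- The element `t ↦ c √(2/π) sin ((j+1) t)` of `L²`, for `c ∈ ℝ^m`; for fixed `j` these form the
eigenspace of the Dirichlet-Laplace operator for the eigenvalue `(j+1)²`. -/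
def sineMode {m : ℕ} (j : ℕ) (c : Euc m) : L2 m := (memLp_sineMode j c).toLp _

/-- The sine coefficient `a_{j+1} = ∫_0^π √(2/π) sin ((j+1) t) x(t) dt ∈ ℝ^m` of `x ∈ L²`. -/
def sineCoeff {m : ℕ} (x : L2 m) (j : ℕ) : Euc m := ∫ t, sineFn j t • x t ∂leb

/-- The eigenvalue `((j+1)²)^β` of `(-Δ)^β`. -/
def eigval (β : ℝ) (j : ℕ) : ℝ := (((j : ℝ) + 1) ^ 2) ^ β

theorem eigval_pos (β : ℝ) (j : ℕ) : 0 < eigval β j := by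
  unfold eigval; positivity

/-! ### Orthonormality and completeness of the sine system -/

theorem integral_cos_nat_mul (n : ℕ) :
    ∫ t in (0 : ℝ)..Real.pi, Real.cos ((n : ℝ) * t) = if n = 0 then Real.pi else 0 := by
  split_ifs with h
  · simp [h]
  · have hn : (n : ℝ) ≠ 0 := by exact_mod_cast h
    rw [intervalIntegral.integral_comp_mul_left (fun s => Real.cos s) hn]
    simp [Real.sin_nat_mul_pi]

theorem integral_sineFn_mul (i j : ℕ) :
    ∫ t, sineFn i t * sineFn j t ∂leb = if i = j then 1 else 0 := by
  have key : ∀ a b : ℕ, a ≤ b →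
      ∫ t, sineFn a t * sineFn b t ∂leb = if a = b then 1 else 0 := by
    intro a b hab
    have hpi := Real.pi_pos
    rw [← integral_Ioc_eq_integral_Ioo, ← intervalIntegral.integral_of_le hpi.le]
    have hf : ∀ t : ℝ, sineFn a t * sineFn b t
        = (1 / Real.pi) * (Real.cos (((b - a : ℕ) : ℝ) * t)
            - Real.cos (((a + b + 2 : ℕ) : ℝ) * t)) := by
      intro t
      have hs : Real.sqrt (2 / Real.pi) * Real.sqrt (2 / Real.pi) = 2 / Real.pi :=
        Real.mul_self_sqrt (by positivity)
      have h1 : (((b - a : ℕ) : ℝ) * t) = ((b : ℝ) + 1) * t - ((a : ℝ) + 1) * t := by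
        rw [Nat.cast_sub hab]; ring
      have h2 : (((a + b + 2 : ℕ) : ℝ) * t) = ((b : ℝ) + 1) * t + ((a : ℝ) + 1) * t := by
        push_cast; ring
      rw [h1, h2, Real.cos_sub, Real.cos_add]
      unfold sineFn
      calc _ = (Real.sqrt (2 / Real.pi) * Real.sqrt (2 / Real.pi)) *
            (Real.sin (((a : ℝ) + 1) * t) * Real.sin (((b : ℝ) + 1) * t)) := by ring
        _ = _ := by rw [hs]; ring
    simp_rw [hf]
    rw [intervalIntegral.integral_const_mul, intervalIntegral.integral_sub
      (Continuous.intervalIntegrable (by fun_prop) _ _)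
      (Continuous.intervalIntegrable (by fun_prop) _ _),
      integral_cos_nat_mul, integral_cos_nat_mul]
    by_cases h : a = b
    · subst h; simp
    · have : b - a ≠ 0 := by omega
      simp [h, this]
  rcases le_total i j with h | h
  · exact key i j h
  · have := key j i h
    simp_rw [mul_comm (sineFn i _), this, eq_comm]

theorem inner_sineMode_left {m : ℕ} (j : ℕ) (c : Euc m) (x : L2 m) :
    inner ℝ (sineMode j c) x = inner ℝ c (sineCoeff x j) := by
  have hx : Integrable (fun t => sineFn j t • x t) leb := by
    have h1 : Integrable (x : ℝ → Euc m) leb := (Lp.memLp x).integrable (by norm_num)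
    refine h1.bdd_smul (Real.sqrt (2 / Real.pi))
      (continuous_sineFn j).aestronglyMeasurable (Eventually.of_forall fun t => ?_)
    exact abs_sineFn_le j t
  rw [L2.inner_def, sineCoeff, ← integral_inner hx c]
  refine integral_congr_ae ?_
  filter_upwards [(memLp_sineMode j c).coeFn_toLp] with t ht
  rw [sineMode, ht, real_inner_smul_left, real_inner_smul_right]

theorem sineCoeff_sineMode {m : ℕ} (i j : ℕ) (c : Euc m) :
    sineCoeff (sineMode j c) i = if i = j then c else 0 := by
  have : sineCoeff (sineMode j c) i = ∫ t, (sineFn i t * sineFn j t) • c ∂leb := by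
    refine integral_congr_ae ?_
    filter_upwards [(memLp_sineMode j c).coeFn_toLp] with t ht
    rw [sineMode, ht, smul_smul]
  rw [this, integral_smul_const, integral_sineFn_mul]
  split_ifs <;> simp

/-- The map `c ↦ c √(2/π) sin ((j+1) t)` as a linear isometry `ℝ^m → L²`. -/
def sineModeₗᵢ (m : ℕ) (j : ℕ) : Euc m →ₗᵢ[ℝ] L2 m where
  toFun := sineMode j
  map_add' c d := by
    rw [sineMode, sineMode, sineMode, ← MemLp.toLp_add]
    congr 1; ext1 t; simp
  map_smul' k c := by
    rw [sineMode, sineMode, RingHom.id_apply, ← MemLp.toLp_const_smul]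
    congr 1; ext1 t; simp [smul_comm k]
  norm_map' c := by
    have h : inner ℝ (sineMode j c) (sineMode j c) = inner ℝ c c := by
      rw [inner_sineMode_left, sineCoeff_sineMode, if_pos rfl]
    rw [real_inner_self_eq_norm_sq, real_inner_self_eq_norm_sq] at h
    exact (sq_eq_sq₀ (norm_nonneg _) (norm_nonneg _)).1 h

theorem orthogonalFamily_sineMode (m : ℕ) :
    OrthogonalFamily ℝ (fun _ : ℕ => Euc m) (sineModeₗᵢ m) := by
  intro i j hij c d
  change inner ℝ (sineMode i c) (sineMode j d) = 0
  rw [inner_sineMode_left, sineCoeff_sineMode, if_neg hij, inner_zero_right]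

/-- The sine coefficients as continuous linear maps. -/
theorem sineCoeff_eq_adjoint {m : ℕ} (x : L2 m) (j : ℕ) :
    sineCoeff x j = ContinuousLinearMap.adjoint (sineModeₗᵢ m j).toContinuousLinearMap x := by
  refine ext_inner_left ℝ fun c => ?_
  rw [ContinuousLinearMap.adjoint_inner_right]
  exact (inner_sineMode_left j c x).symm

theorem sineCoeff_add {m : ℕ} (x y : L2 m) (j : ℕ) :
    sineCoeff (x + y) j = sineCoeff x j + sineCoeff y j := by
  simp only [sineCoeff_eq_adjoint, map_add]

theorem sineCoeff_smul {m : ℕ} (k : ℝ) (x : L2 m) (j : ℕ) :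
    sineCoeff (k • x) j = k • sineCoeff x j := by
  simp only [sineCoeff_eq_adjoint, map_smul]

theorem sineCoeff_zero {m : ℕ} (j : ℕ) : sineCoeff (0 : L2 m) j = 0 := by
  simp only [sineCoeff_eq_adjoint, map_zero]

/-- Completeness of the sine system in `L²`. -/
theorem eq_zero_of_sineCoeff_eq_zero {m : ℕ} (x : L2 m) (h : ∀ j, sineCoeff x j = 0) : x = 0 := by
  have hpi := Real.pi_pos
  have hxi : Integrable (x : ℝ → Euc m) leb := (Lp.memLp x).integrable (by norm_num)
  have hbd : ∀ (w : ℝ → ℝ), Continuous w → (∃ C, ∀ t, |w t| ≤ C) →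
      Integrable (fun t => w t • x t) leb := by
    rintro w hw ⟨C, hC⟩
    exact hxi.bdd_smul C hw.aestronglyMeasurable (Eventually.of_forall fun t => hC t)
  -- all `cos^k t sin (n t)` are orthogonal to `x`
  have hcs_bd : ∀ k n : ℕ, ∃ C, ∀ t : ℝ, |Real.cos t ^ k * Real.sin (n * t)| ≤ C := by
    intro k n
    refine ⟨1, fun t => ?_⟩
    rw [abs_mul, abs_pow]
    exact mul_le_one₀ (pow_le_one₀ (abs_nonneg _) (Real.abs_cos_le_one t)) (abs_nonneg _)
      (Real.abs_sin_le_one _)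
  have hcs_int : ∀ k n : ℕ,
      Integrable (fun t => (Real.cos t ^ k * Real.sin (n * t)) • x t) leb :=
    fun k n => hbd _ (by fun_prop) (hcs_bd k n)
  have hcs : ∀ k n : ℕ, ∫ t, (Real.cos t ^ k * Real.sin (n * t)) • x t ∂leb = 0 := by
    intro k
    induction k with
    | zero =>
      intro n
      rcases n with _ | n
      · simp
      · have h1 := h n
        unfold sineCoeff sineFn at h1
        simp_rw [mul_smul] at h1
        rw [integral_smul, smul_eq_zero] at h1
        rcases h1 with h1 | h1
        · exact absurd h1 (Real.sqrt_pos.2 (by positivity)).ne'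
        · simpa using h1
    | succ k ih =>
      intro n
      rcases n with _ | n
      · simp
      · have e : ∀ t, (Real.cos t ^ (k + 1) * Real.sin ((n + 1 : ℕ) * t)) • x t
            = (1 / 2 : ℝ) • ((Real.cos t ^ k * Real.sin ((n + 2 : ℕ) * t)) • x t)
              + (1 / 2 : ℝ) • ((Real.cos t ^ k * Real.sin ((n : ℕ) * t)) • x t) := by
          intro t
          rw [smul_smul, smul_smul, ← add_smul]
          congr 1
          have h1 : (((n + 2 : ℕ) : ℝ) * t) = ((n + 1 : ℕ) : ℝ) * t + t := by push_cast; ring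
          have h2 : ((n : ℝ) * t) = ((n + 1 : ℕ) : ℝ) * t - t := by push_cast; ring
          rw [h1, h2, Real.sin_add, Real.sin_sub]; ring
        simp_rw [e]
        have hadd := integral_add ((hcs_int k (n + 2)).smul (1 / 2 : ℝ))
          ((hcs_int k n).smul (1 / 2 : ℝ))
        simp only [Pi.smul_apply] at hadd
        rw [hadd, integral_smul, integral_smul, ih, ih]
        simp
  have hpoly : ∀ p : Polynomial ℝ, Integrable (fun t => (p.eval (Real.cos t) * Real.sin t) • x t) leb
      ∧ ∫ t, (p.eval (Real.cos t) * Real.sin t) • x t ∂leb = 0 := by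
    intro p
    induction p using Polynomial.induction_on' with
    | add p q hp hq =>
      have e : ∀ t, ((p + q).eval (Real.cos t) * Real.sin t) • x t
          = (p.eval (Real.cos t) * Real.sin t) • x t
            + (q.eval (Real.cos t) * Real.sin t) • x t := by
        intro t; rw [Polynomial.eval_add, add_mul, add_smul]
      simp_rw [e]
      exact ⟨hp.1.add hq.1, by rw [integral_add hp.1 hq.1, hp.2, hq.2, add_zero]⟩
    | monomial k a =>
      have e : ∀ t, ((Polynomial.monomial k a).eval (Real.cos t) * Real.sin t) • x t
          = a • ((Real.cos t ^ k * Real.sin ((1 : ℕ) * t)) • x t) := by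
        intro t; rw [Polynomial.eval_monomial, smul_smul, Nat.cast_one, one_mul, mul_assoc]
      simp_rw [e]
      exact ⟨(hcs_int k 1).smul a, by rw [integral_smul, hcs k 1, smul_zero]⟩
  -- hence `x` is orthogonal to every test function
  have htest : ∀ g : ℝ → ℝ, ContDiff ℝ (⊤ : ℕ∞) g → HasCompactSupport g →
      tsupport g ⊆ Ioo 0 Real.pi → ∫ t, g t • x t ∂leb = 0 := by
    intro g hg hgc hgs
    -- `ψ = g / sin`, transported to `[-1, 1]` by `arccos`
    set ψ : ℝ → ℝ := fun t => g t / Real.sin t with hψ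
    have hψc : Continuous ψ := by
      rw [continuous_iff_continuousAt]
      intro t
      by_cases ht : t ∈ Ioo 0 Real.pi
      · exact hg.continuous.continuousAt.div Real.continuous_sin.continuousAt
          (Real.sin_pos_of_mem_Ioo ht).ne'
      · have h0 : g =ᶠ[𝓝 t] 0 := notMem_tsupport_iff_eventuallyEq.1 fun h' => ht (hgs h')
        have h1 : ψ =ᶠ[𝓝 t] fun _ => 0 := by
          filter_upwards [h0] with s hs
          simp [hψ, hs]
        exact continuousAt_const.congr h1.symm
    have hψeq : ∀ t ∈ Ioo 0 Real.pi, g t = ψ t * Real.sin t := by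
      intro t ht
      exact (div_mul_cancel₀ _ (Real.sin_pos_of_mem_Ioo ht).ne').symm
    have hgi : Integrable (fun t => g t • x t) leb := by
      obtain ⟨C, hC⟩ := hgc.exists_bound_of_continuous hg.continuous
      exact hbd g hg.continuous ⟨C, hC⟩
    have hle : ∀ ε > 0, ‖∫ t, g t • x t ∂leb‖ ≤ ε * ∫ t, ‖x t‖ ∂leb := by
      intro ε hε
      obtain ⟨p, hp⟩ := exists_polynomial_near_of_continuousOn (-1) 1 (fun s => ψ (Real.arccos s))
        (hψc.comp Real.continuous_arccos).continuousOn ε hε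
      have e : ∫ t, g t • x t ∂leb
          = ∫ t, (g t • x t - (p.eval (Real.cos t) * Real.sin t) • x t) ∂leb := by
        rw [integral_sub hgi (hpoly p).1, (hpoly p).2, sub_zero]
      rw [e, ← integral_const_mul]
      refine norm_integral_le_of_norm_le (hxi.norm.const_mul ε) ?_
      filter_upwards [ae_restrict_mem measurableSet_Ioo] with t ht
      rw [← sub_smul, norm_smul, hψeq t ht, ← sub_mul]
      refine mul_le_mul_of_nonneg_right ?_ (norm_nonneg _)
      have h1 := hp (Real.cos t) ⟨Real.neg_one_le_cos t, Real.cos_le_one t⟩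
      rw [Real.arccos_cos ht.1.le ht.2.le, abs_sub_comm] at h1
      rw [norm_mul, Real.norm_eq_abs, Real.norm_eq_abs]
      exact (mul_le_of_le_one_right (abs_nonneg _) (Real.abs_sin_le_one t)).trans h1.le
    have hI : 0 ≤ ∫ t, ‖x t‖ ∂leb := integral_nonneg fun t => norm_nonneg _
    rw [← norm_le_zero_iff]
    refine le_of_forall_pos_le_add fun δ hδ => ?_
    refine (hle (δ / (1 + ∫ t, ‖x t‖ ∂leb)) (by positivity)).trans ?_
    rw [zero_add, div_mul_eq_mul_div, div_le_iff₀ (by positivity)]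
    nlinarith
  have hae := IsOpen.ae_eq_zero_of_integral_contDiff_smul_eq_zero (μ := leb) isOpen_Ioo
    (f := (x : ℝ → Euc m)) (hxi.locallyIntegrable.locallyIntegrableOn _) htest
  refine Lp.eq_zero_iff_ae_eq_zero.2 ?_
  filter_upwards [hae, ae_restrict_mem measurableSet_Ioo] with t ht1 ht2
  exact ht1 ht2

/-! ### The Dirichlet-Laplace operator of order `β` -/

/-- The domain `D((-Δ)^β)`: all `x = ∑ a_j √(2/π) sin (j t) ∈ L²` with
`∑ ((j²)^β)² |a_j|² < ∞`. -/
def domain (m : ℕ) (β : ℝ) : Submodule ℝ (L2 m) where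
  carrier := {x | Summable fun j => ‖eigval β j • sineCoeff x j‖ ^ 2}
  zero_mem' := by
    simp [sineCoeff_zero, summable_zero]
  add_mem' := by
    intro x y hx hy
    refine Summable.of_nonneg_of_le (fun j => by positivity) (fun j => ?_)
      ((hx.mul_left 2).add (hy.mul_left 2))
    rw [sineCoeff_add, smul_add]
    have h := norm_add_le (eigval β j • sineCoeff x j) (eigval β j • sineCoeff y j)
    have h2 := pow_le_pow_left₀ (norm_nonneg _) h 2
    nlinarith [sq_nonneg (‖eigval β j • sineCoeff x j‖ - ‖eigval β j • sineCoeff y j‖)]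
  smul_mem' := by
    intro k x hx
    refine (Summable.mul_left (k ^ 2) hx).congr fun j => ?_
    rw [sineCoeff_smul, smul_comm, norm_smul k, mul_pow, Real.norm_eq_abs, sq_abs]

/-- `D((-Δ)^β)` as a type of its own: its norm is not the one of `L²`. -/
def Dom (m : ℕ) (β : ℝ) : Type := ↥(domain m β)

instance (m : ℕ) (β : ℝ) : AddCommGroup (Dom m β) := inferInstanceAs (AddCommGroup ↥(domain m β))

instance (m : ℕ) (β : ℝ) : Module ℝ (Dom m β) := inferInstanceAs (Module ℝ ↥(domain m β))

/-- The inclusion `D((-Δ)^β) → L²`. -/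
def Dom.incl {m : ℕ} {β : ℝ} : Dom m β →ₗ[ℝ] L2 m := (domain m β).subtype

theorem hasSum_fracLaplacian {m : ℕ} {β : ℝ} (x : Dom m β) :
    HasSum (fun j => sineMode j (eigval β j • sineCoeff x.incl j))
      (∑' j, sineMode j (eigval β j • sineCoeff x.incl j)) :=
  (((orthogonalFamily_sineMode m).summable_iff_norm_sq_summable
    (fun j => eigval β j • sineCoeff x.incl j)).2 x.2).hasSum

/-- The operator `(-Δ)^β : D((-Δ)^β) → L²`,
`(-Δ)^β x = ∑ (j²)^β a_j √(2/π) sin (j t)` (convergence in `L²`) for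
`x = ∑ a_j √(2/π) sin (j t)`. -/
def fracLaplacian (m : ℕ) (β : ℝ) : Dom m β →ₗ[ℝ] L2 m where
  toFun x := ∑' j, sineMode j (eigval β j • sineCoeff x.incl j)
  map_add' x y := by
    refine (((hasSum_fracLaplacian x).add (hasSum_fracLaplacian y)).congr_fun fun j => ?_).tsum_eq
    rw [map_add, sineCoeff_add, smul_add]
    exact map_add (sineModeₗᵢ m j) _ _
  map_smul' k x := by
    refine (((hasSum_fracLaplacian x).const_smul k).congr_fun fun j => ?_).tsum_eq
    rw [map_smul, sineCoeff_smul, smul_comm]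
    exact map_smul (sineModeₗᵢ m j) _ _

theorem sineCoeff_fracLaplacian {m : ℕ} {β : ℝ} (x : Dom m β) (i : ℕ) :
    sineCoeff (fracLaplacian m β x) i = eigval β i • sineCoeff x.incl i := by
  have h := (hasSum_fracLaplacian x).mapL
    (ContinuousLinearMap.adjoint (sineModeₗᵢ m i).toContinuousLinearMap)
  simp_rw [← sineCoeff_eq_adjoint, sineCoeff_sineMode] at h
  refine h.unique ?_
  have := hasSum_ite_eq i (eigval β i • sineCoeff x.incl i)
  refine this.congr_fun fun j => ?_
  by_cases hij : i = j
  · subst hij; simp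
  · simp [hij, Ne.symm hij]

theorem fracLaplacian_injective (m : ℕ) (β : ℝ) : Function.Injective (fracLaplacian m β) := by
  refine (injective_iff_map_eq_zero _).2 fun x hx => ?_
  refine Subtype.ext (eq_zero_of_sineCoeff_eq_zero x.incl fun j => ?_)
  have h := sineCoeff_fracLaplacian x j
  rw [hx, sineCoeff_zero, eq_comm, smul_eq_zero] at h
  exact h.resolve_left (eigval_pos β j).ne'

/-- `D((-Δ)^β)` carries the norm `‖x‖ = ‖(-Δ)^β x‖_{L²}`. -/
instance (m : ℕ) (β : ℝ) : NormedAddCommGroup (Dom m β) :=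
  NormedAddCommGroup.induced (Dom m β) (L2 m) (fracLaplacian m β) (fracLaplacian_injective m β)

/-- The scalar product `⟨x, y⟩ = ⟨(-Δ)^β x, (-Δ)^β y⟩_{L²}` on `D((-Δ)^β)`. -/
instance (m : ℕ) (β : ℝ) : InnerProductSpace ℝ (Dom m β) where
  toNormedSpace := NormedSpace.induced ℝ (Dom m β) (L2 m) (fracLaplacian m β)
  inner x y := inner ℝ (fracLaplacian m β x) (fracLaplacian m β y)
  norm_sq_eq_re_inner x := norm_sq_eq_re_inner (𝕜 := ℝ) (fracLaplacian m β x)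
  conj_inner_symm x y := inner_conj_symm (𝕜 := ℝ) _ _
  add_left x y z := by rw [map_add, inner_add_left]
  smul_left x y k := by rw [map_smul, inner_smul_left]

theorem Dom.norm_eq {m : ℕ} {β : ℝ} (x : Dom m β) : ‖x‖ = ‖fracLaplacian m β x‖ := rfl

/-! ### The functional `φ` and the Palais-Smale condition -/

/-- The function `t ↦ (-Δ)^β x(t) - f(t, x(t), u(t))`, i.e. `F(x, u)`. -/
def residual {m r : ℕ} {β : ℝ} (f : ℝ → Euc m → Euc r → Euc m) (x : Dom m β) (u : LInf r) :
    ℝ → Euc m :=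
  fun t => fracLaplacian m β x t - f t (x.incl t) (u t)

/-- The functional `φ(x) = ½ ‖F(x, u)‖²_{L²}` on `D((-Δ)^β)`. -/
def energy {m r : ℕ} {β : ℝ} (f : ℝ → Euc m → Euc r → Euc m) (u : LInf r) (x : Dom m β) : ℝ :=
  (1 / 2) * (eLpNorm (residual f x u) 2 leb).toReal ^ 2

/-- A functional `I : X → ℝ` of class `C¹` satisfies the Palais-Smale condition: every sequence
`(x_k)` with `I(x_k)` bounded and `I'(x_k) → 0` (in the norm of the dual space) has a convergent
subsequence. -/
structure PalaisSmale {X : Type*} [NormedAddCommGroup X] [NormedSpace ℝ X] (I : X → ℝ) : Prop where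
  contDiff : ContDiff ℝ 1 I
  exists_subseq : ∀ x : ℕ → X, (∃ M : ℝ, ∀ k, |I (x k)| ≤ M) →
    Tendsto (fun k => fderiv ℝ I (x k)) atTop (𝓝 0) →
    ∃ (x₀ : X) (σ : ℕ → ℕ), StrictMono σ ∧ Tendsto (fun k => x (σ k)) atTop (𝓝 x₀)

end DirichletLaplace

end

open DirichletLaplace

/-! Write `F(x) = A x - N(x)` with `A = (-Δ)^β`, a linear isometry of the domain onto `L²`, and `N`
the superposition operator of `f(·, ·, u(·))`.

For `β > 1/2` the sine coefficients of `x` are summable, and Cauchy–Schwarz with Bessel's inequality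
bounds the continuous representative by `√(2ζ(4β)/π) ‖x‖`. Only values in a fixed ball are then met
near a given `x`, so one `L²` function dominates `f` and `f_x`, and dominated convergence makes `N`,
hence `φ`, of class `C¹` (`contDiff_operator`).

Linear growth gives `‖N(x)‖ ≤ q‖x‖ + C` with `q < 1` by the smallness condition
(`norm_operator_control_le`). Since `‖x‖ = ‖A x‖ ≤ ‖F(x)‖ + ‖N(x)‖`, a Palais–Smale sequence is
bounded. The embedding into the bounded functions is compact (`exists_subseq_evalAt_cauchy`), so a
subsequence is uniformly Cauchy. For a difference `d` of two of its terms, `‖d‖² = ⟨A d, A d⟩`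
splits into values of `φ'`, which tend to zero, and terms with `N` or `N'`, controlled by the sup
norm of `d`. The subsequence is therefore Cauchy in the domain, which is complete because `A` is
onto. -/

namespace Nemytskii

/-! ### Superposition with bounded functions: measurability and `L²` bounds -/

variable {α : Type*} [MeasurableSpace α] {μ : Measure α}
  {X : Type*} [NormedAddCommGroup X] [NormedSpace ℝ X]
  {E : Type*} [NormedAddCommGroup E] [NormedSpace ℝ E]
  {F : Type*} [NormedAddCommGroup F] [NormedSpace ℝ F]

/-- Dominated convergence to zero in `L²`. -/
theorem tendsto_eLpNorm_two_zero {ι G : Type*} [NormedAddCommGroup G] {l : Filter ι}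
    [l.IsCountablyGenerated]
    {φ : ι → α → G} {k : α → ℝ} (hk : MemLp k 2 μ)
    (hmeas : ∀ᶠ n in l, AEStronglyMeasurable (φ n) μ)
    (hbound : ∀ᶠ n in l, ∀ᵐ t ∂μ, ‖φ n t‖ ≤ k t)
    (hlim : ∀ᵐ t ∂μ, Tendsto (fun n => ‖φ n t‖) l (𝓝 0)) :
    Tendsto (fun n => eLpNorm (φ n) 2 μ) l (𝓝 0) := by
  have h := tendsto_lintegral_filter_of_dominated_convergence' (μ := μ) (l := l)
    (F := fun n t => ‖φ n t‖ₑ ^ (2 : ℝ)) (f := fun _ => 0) (fun t => ‖k t‖ₑ ^ (2 : ℝ))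
    (hmeas.mono fun n hn => hn.enorm.pow_const _)
    (hbound.mono fun n hn => by
      filter_upwards [hn] with t ht
      exact ENNReal.rpow_le_rpow (enorm_le_iff_norm_le.2 (ht.trans (le_abs_self _))) (by norm_num))
    (by
      have := hk.eLpNorm_lt_top
      rw [eLpNorm_eq_lintegral_rpow_enorm_toReal (by norm_num) (by norm_num)] at this
      rw [ENNReal.toReal_ofNat, ENNReal.rpow_lt_top_iff_of_pos (by norm_num)] at this
      exact this.ne)
    (by
      filter_upwards [hlim] with t ht
      have h1 : Tendsto (fun n => ‖φ n t‖ₑ) l (𝓝 0) := by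
        have := ENNReal.tendsto_ofReal ht
        simpa using this
      have h2 := h1.ennrpow_const (2 : ℝ)
      simpa using h2)
  have h2 := h.ennrpow_const (1 / 2 : ℝ)
  simp only [lintegral_zero] at h2
  rw [ENNReal.zero_rpow_of_pos (by norm_num)] at h2
  refine h2.congr fun n => ?_
  rw [eLpNorm_eq_lintegral_rpow_enorm_toReal (by norm_num) (by norm_num)]
  simp

/-- Superposition of a Carathéodory function with a measurable function is measurable. -/
theorem aestronglyMeasurable_superposition {E F : Type*} [NormedAddCommGroup E]
    [NormedAddCommGroup F] {g : α → E → F}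
    (hmeas : ∀ x, AEStronglyMeasurable (fun t => g t x) μ) (hcont : ∀ᵐ t ∂μ, Continuous (g t))
    {v : α → E} (hv : AEStronglyMeasurable v μ) :
    AEStronglyMeasurable (fun t => g t (v t)) μ := by
  obtain ⟨w, hw, hvw⟩ := hv
  -- For a simple function the superposition is a finite sum over its fibres; continuity of `g t`
  -- carries measurability to pointwise limits.
  have key : ∀ s : SimpleFunc α E, AEStronglyMeasurable (fun t => g t (s t)) μ := by
    intro s
    classical
    have e : (fun t => g t (s t))
        = fun t => ∑ y ∈ s.range, (s ⁻¹' {y}).indicator (fun t => g t y) t := by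
      ext t
      rw [Finset.sum_eq_single (s t)]
      · simp
      · intro y _ hy
        rw [indicator_of_notMem]
        simpa using hy.symm
      · intro h
        exact absurd (SimpleFunc.mem_range_self s t) h
    rw [e]
    exact Finset.aestronglyMeasurable_fun_sum _ fun y _ =>
      (hmeas y).indicator (s.measurableSet_fiber y)
  have h2 : AEStronglyMeasurable (fun t => g t (w t)) μ := by
    refine aestronglyMeasurable_of_tendsto_ae atTop (fun n => key (hw.approx n)) ?_
    filter_upwards [hcont] with t ht
    exact (ht.tendsto _).comp (hw.tendsto_approx t)
  refine h2.congr ?_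
  filter_upwards [hvw] with t ht
  rw [ht]

/-- A Carathéodory function of class `C¹` in the second variable that, together with its
derivative, is bounded on every ball by a function in `L²`. -/
structure IsC1Caratheodory (μ : Measure α) (g : α → E → F) (k : ℝ → α → ℝ) : Prop where
  meas : ∀ x, AEStronglyMeasurable (fun t => g t x) μ
  contDiff : ∀ᵐ t ∂μ, ContDiff ℝ 1 (g t)
  memLp : ∀ R, MemLp (k R) 2 μ
  norm_le : ∀ᵐ t ∂μ, ∀ R x, ‖x‖ ≤ R → ‖g t x‖ ≤ k R t
  norm_fderiv_le : ∀ᵐ t ∂μ, ∀ R x, ‖x‖ ≤ R → ‖fderiv ℝ (g t) x‖ ≤ k R t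

/-- A measurable bounded family of continuous linear maps, regarded as a map from `X` to the
bounded functions. -/
structure IsBoundedEval (μ : Measure α) (e : α → X →L[ℝ] E) (K : ℝ) : Prop where
  meas : ∀ x, AEStronglyMeasurable (fun t => e t x) μ
  norm_le : ∀ t x, ‖e t x‖ ≤ K * ‖x‖

variable {g : α → E → F} {k : ℝ → α → ℝ} {e : α → X →L[ℝ] E} {K : ℝ}

namespace IsC1Caratheodory

theorem aestronglyMeasurable_comp (hg : IsC1Caratheodory μ g k) {v : α → E}
    (hv : AEStronglyMeasurable v μ) : AEStronglyMeasurable (fun t => g t (v t)) μ :=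
  aestronglyMeasurable_superposition hg.meas (hg.contDiff.mono fun _ h => h.continuous) hv

/-- The directional derivative is the limit of the difference quotients with step `1/n`, each of
them measurable. -/
theorem aestronglyMeasurable_fderiv_apply (hg : IsC1Caratheodory μ g k) {v w : α → E}
    (hv : AEStronglyMeasurable v μ) (hw : AEStronglyMeasurable w μ) :
    AEStronglyMeasurable (fun t => fderiv ℝ (g t) (v t) (w t)) μ := by
  refine aestronglyMeasurable_of_tendsto_ae atTop
    (f := fun (n : ℕ) t => (n : ℝ) • (g t (v t + (n : ℝ)⁻¹ • w t) - g t (v t)))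
    (fun n => ((hg.aestronglyMeasurable_comp (hv.add (hw.const_smul _))).sub
      (hg.aestronglyMeasurable_comp hv)).const_smul _) ?_
  filter_upwards [hg.contDiff] with t ht
  refine ((ht.differentiable one_ne_zero) (v t)).hasFDerivAt.lim (w t) ?_
  simpa using tendsto_natCast_atTop_atTop

/-- Finite dimension reduces a derivative, as an operator-valued function, to its values on a basis.
-/
theorem aestronglyMeasurable_fderiv [FiniteDimensional ℝ E] (hg : IsC1Caratheodory μ g k)
    {v : α → E} (hv : AEStronglyMeasurable v μ) :
    AEStronglyMeasurable (fun t => fderiv ℝ (g t) (v t)) μ := by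
  set b := Module.finBasis ℝ E
  have e : (fun t => fderiv ℝ (g t) (v t)) = fun t => ∑ i,
      ContinuousLinearMap.smulRightL ℝ E F (LinearMap.toContinuousLinearMap (b.coord i))
        (fderiv ℝ (g t) (v t) (b i)) := by
    ext t y
    conv_lhs => rw [← b.sum_repr y, map_sum]
    simp [sum_apply]
  rw [e]
  exact Finset.aestronglyMeasurable_fun_sum _ fun i _ =>
    (ContinuousLinearMap.continuous _).comp_aestronglyMeasurable
      (hg.aestronglyMeasurable_fderiv_apply hv aestronglyMeasurable_const)

theorem memLp_comp (hg : IsC1Caratheodory μ g k) {v : α → E} {R : ℝ}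
    (hv : AEStronglyMeasurable v μ) (hR : ∀ t, ‖v t‖ ≤ R) : MemLp (fun t => g t (v t)) 2 μ := by
  refine (hg.memLp R).mono (hg.aestronglyMeasurable_comp hv) ?_
  filter_upwards [hg.norm_le] with t ht
  exact (ht R _ (hR t)).trans (le_abs_self _)

theorem ae_norm_fderiv_apply_le (hg : IsC1Caratheodory μ g k) {v w : α → E} {R C : ℝ}
    (hR : ∀ t, ‖v t‖ ≤ R) (hC : ∀ t, ‖w t‖ ≤ C) :
    ∀ᵐ t ∂μ, ‖fderiv ℝ (g t) (v t) (w t)‖ ≤ C * ‖k R t‖ := by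
  filter_upwards [hg.norm_fderiv_le] with t ht
  rw [mul_comm]
  refine ((fderiv ℝ (g t) (v t)).le_opNorm _).trans ?_
  exact mul_le_mul ((ht R _ (hR t)).trans (le_abs_self _)) (hC t) (norm_nonneg _) (norm_nonneg _)

/-- Mean value inequality on the closed ball of radius `R`, which is convex. -/
theorem ae_norm_sub_le (hg : IsC1Caratheodory μ g k) {v w : α → E} {R C : ℝ}
    (hR : ∀ t, ‖v t‖ ≤ R) (hR' : ∀ t, ‖w t‖ ≤ R) (hC : ∀ t, ‖v t - w t‖ ≤ C) :
    ∀ᵐ t ∂μ, ‖g t (v t) - g t (w t)‖ ≤ C * ‖k R t‖ := by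
  filter_upwards [hg.norm_fderiv_le, hg.contDiff] with t ht hs
  have h := (convex_closedBall (0 : E) R).norm_image_sub_le_of_norm_fderiv_le (𝕜 := ℝ) (f := g t)
    (C := ‖k R t‖) (x := w t) (y := v t)
    (fun x _ => (hs.differentiable one_ne_zero) x)
    (fun x hx => (ht R x (by simpa using hx)).trans (le_abs_self _))
    (by simpa using hR' t) (by simpa using hR t)
  rw [mul_comm]
  exact h.trans (mul_le_mul_of_nonneg_left (hC t) (norm_nonneg _))

theorem memLp_fderiv_apply (hg : IsC1Caratheodory μ g k) {v w : α → E} {R C : ℝ}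
    (hv : AEStronglyMeasurable v μ) (hw : AEStronglyMeasurable w μ)
    (hR : ∀ t, ‖v t‖ ≤ R) (hC : ∀ t, ‖w t‖ ≤ C) :
    MemLp (fun t => fderiv ℝ (g t) (v t) (w t)) 2 μ :=
  ((hg.memLp R).norm).of_le_mul (c := C) (hg.aestronglyMeasurable_fderiv_apply hv hw)
    (by simpa using hg.ae_norm_fderiv_apply_le hR hC)

end IsC1Caratheodory

/-! ### The superposition operator into `L²` and its derivative -/

/-- A bound of the `L²` norm by a multiple of the `L²` norm of a dominating function. -/
theorem toReal_eLpNorm_le {G H : Type*} [NormedAddCommGroup G] [NormedAddCommGroup H]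
    {φ : α → G} {ψ : α → H} {C : ℝ} (hC : 0 ≤ C)
    (hψ : MemLp ψ 2 μ) (h : ∀ᵐ t ∂μ, ‖φ t‖ ≤ C * ‖ψ t‖) :
    (eLpNorm φ 2 μ).toReal ≤ C * (eLpNorm ψ 2 μ).toReal := by
  have := ENNReal.toReal_mono
    (ENNReal.mul_ne_top ENNReal.ofReal_ne_top hψ.eLpNorm_ne_top)
    (eLpNorm_le_mul_eLpNorm_of_ae_le_mul h 2)
  rwa [ENNReal.toReal_mul, ENNReal.toReal_ofReal hC] at this

/-- The superposition operator `x ↦ g(·, e(·) x)` with values in `L²`. -/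
noncomputable def operator (hg : IsC1Caratheodory μ g k) (he : IsBoundedEval μ e K) (x : X) :
    Lp F 2 μ :=
  (hg.memLp_comp (he.meas x) (fun t => he.norm_le t x)).toLp _

theorem memLp_fderiv_eval (hg : IsC1Caratheodory μ g k) (he : IsBoundedEval μ e K) (x h : X) :
    MemLp (fun t => fderiv ℝ (g t) (e t x) (e t h)) 2 μ :=
  hg.memLp_fderiv_apply (he.meas x) (he.meas h) (fun t => he.norm_le t x)
    (fun t => he.norm_le t h)

/-- The derivative of the superposition operator. -/
noncomputable def deriv (hg : IsC1Caratheodory μ g k) (he : IsBoundedEval μ e K) (x : X) :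
    X →L[ℝ] Lp F 2 μ :=
  LinearMap.mkContinuous
    { toFun := fun h => (memLp_fderiv_eval hg he x h).toLp _
      map_add' := fun h h' => by
        rw [← MemLp.toLp_add]
        congr 1; ext1 t; simp
      map_smul' := fun c h => by
        rw [RingHom.id_apply, ← MemLp.toLp_const_smul]
        congr 1; ext1 t; simp }
    -- `K` has no assumed sign, hence the absolute value.
    (|K| * (eLpNorm (k (K * ‖x‖)) 2 μ).toReal) (fun h => by
      change ‖(memLp_fderiv_eval hg he x h).toLp _‖ ≤ _
      rw [Lp.norm_toLp, mul_right_comm]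
      refine toReal_eLpNorm_le (by positivity) (hg.memLp _) ?_
      refine hg.ae_norm_fderiv_apply_le (fun t => he.norm_le t x) fun t => (he.norm_le t h).trans ?_
      exact mul_le_mul_of_nonneg_right (le_abs_self _) (norm_nonneg _))

theorem coeFn_operator (hg : IsC1Caratheodory μ g k) (he : IsBoundedEval μ e K) (x : X) :
    operator hg he x =ᵐ[μ] fun t => g t (e t x) :=
  MemLp.coeFn_toLp _

theorem coeFn_deriv (hg : IsC1Caratheodory μ g k) (he : IsBoundedEval μ e K) (x h : X) :
    deriv hg he x h =ᵐ[μ] fun t => fderiv ℝ (g t) (e t x) (e t h) :=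
  MemLp.coeFn_toLp (memLp_fderiv_eval hg he x h)

theorem norm_operator_sub_le (hg : IsC1Caratheodory μ g k) (he : IsBoundedEval μ e K) {x y : X}
    {R C : ℝ} (hx : ∀ t, ‖e t x‖ ≤ R) (hy : ∀ t, ‖e t y‖ ≤ R) (hC0 : 0 ≤ C)
    (hC : ∀ t, ‖e t (x - y)‖ ≤ C) :
    ‖operator hg he x - operator hg he y‖ ≤ C * (eLpNorm (k R) 2 μ).toReal := by
  rw [operator, operator, ← MemLp.toLp_sub, Lp.norm_toLp]
  refine toReal_eLpNorm_le hC0 (hg.memLp R) (hg.ae_norm_sub_le hx hy fun t => ?_)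
  rw [← map_sub]
  exact hC t

theorem norm_deriv_apply_le (hg : IsC1Caratheodory μ g k) (he : IsBoundedEval μ e K) {x h : X}
    {R C : ℝ} (hx : ∀ t, ‖e t x‖ ≤ R) (hC0 : 0 ≤ C) (hC : ∀ t, ‖e t h‖ ≤ C) :
    ‖deriv hg he x h‖ ≤ C * (eLpNorm (k R) 2 μ).toReal := by
  change ‖(memLp_fderiv_eval hg he x h).toLp _‖ ≤ _
  rw [Lp.norm_toLp]
  exact toReal_eLpNorm_le hC0 (hg.memLp R) (hg.ae_norm_fderiv_apply_le hx hC)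

/-- A common radius for the unit ball around `x` lets a single dominating function `k R` serve all
nearby points. -/
theorem IsBoundedEval.norm_le_of_ball (he : IsBoundedEval μ e K) {x y : X} (hy : ‖y - x‖ ≤ 1)
    (t : α) : ‖e t y‖ ≤ |K| * (‖x‖ + 1) := by
  refine (he.norm_le t y).trans (mul_le_mul (le_abs_self _) ?_ (norm_nonneg _) (abs_nonneg _))
  have := norm_add_le x (y - x)
  rw [add_sub_cancel] at this
  linarith

/-- Dominated convergence applied to the normalized remainder: it tends to zero pointwise by the
chain rule, and its increment and derivative parts are each at most `|K| * ‖k R t‖`. -/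
theorem hasFDerivAt_operator (hg : IsC1Caratheodory μ g k) (he : IsBoundedEval μ e K) (x : X) :
    HasFDerivAt (operator hg he) (deriv hg he x) x := by
  rw [hasFDerivAt_iff_tendsto]
  set R := |K| * (‖x‖ + 1)
  have hball : ∀ᶠ y in 𝓝 x, ‖y - x‖ ≤ 1 := by
    filter_upwards [Metric.closedBall_mem_nhds x one_pos] with y hy
    simpa [dist_eq_norm] using hy
  have hxR : ∀ t, ‖e t x‖ ≤ R := he.norm_le_of_ball (by simp)
  have key := tendsto_eLpNorm_two_zero (μ := μ) (l := 𝓝 x)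
    (φ := fun y t => ‖y - x‖⁻¹ •
      (g t (e t y) - g t (e t x) - fderiv ℝ (g t) (e t x) (e t (y - x))))
    (k := fun t => (2 * |K|) * ‖k R t‖) ((hg.memLp R).norm.const_mul _)
    (Eventually.of_forall fun y => (((hg.aestronglyMeasurable_comp (he.meas y)).sub
      (hg.aestronglyMeasurable_comp (he.meas x))).sub
      (hg.aestronglyMeasurable_fderiv_apply (he.meas x) (he.meas (y - x)))).const_smul _) ?_ ?_
  · rw [← ENNReal.toReal_zero]
    refine ((ENNReal.tendsto_toReal ENNReal.zero_ne_top).comp key).congr fun y => ?_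
    have hae : (fun t => ‖y - x‖⁻¹ •
        (g t (e t y) - g t (e t x) - fderiv ℝ (g t) (e t x) (e t (y - x)))) =ᵐ[μ]
        (‖y - x‖⁻¹ • (operator hg he y - operator hg he x - deriv hg he x (y - x)) : Lp F 2 μ) := by
      filter_upwards [coeFn_operator hg he y, coeFn_operator hg he x,
        coeFn_deriv hg he x (y - x), Lp.coeFn_smul (‖y - x‖⁻¹)
          (operator hg he y - operator hg he x - deriv hg he x (y - x)),
        Lp.coeFn_sub (operator hg he y - operator hg he x) (deriv hg he x (y - x)),
        Lp.coeFn_sub (operator hg he y) (operator hg he x)] with t h1 h2 h3 h4 h5 h6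
      rw [h4, Pi.smul_apply, h5, Pi.sub_apply, h6, Pi.sub_apply, h1, h2, h3]
    rw [Function.comp_apply, eLpNorm_congr_ae hae, ← Lp.norm_def, norm_smul, norm_inv, norm_norm]
  · filter_upwards [hball] with y hy
    have hyx : ∀ t, ‖e t (y - x)‖ ≤ |K| * ‖y - x‖ := fun t => (he.norm_le t _).trans
      (mul_le_mul_of_nonneg_right (le_abs_self _) (norm_nonneg _))
    filter_upwards [hg.ae_norm_sub_le (he.norm_le_of_ball hy) hxR
        (fun t => by rw [← map_sub]; exact hyx t),
      hg.ae_norm_fderiv_apply_le hxR hyx] with t h1 h2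
    rw [norm_smul, norm_inv, norm_norm]
    -- If `‖y - x‖ = 0`, its inverse is `0` by convention and the bound is trivial.
    rcases (norm_nonneg (y - x)).eq_or_lt with h0 | h0
    · rw [← h0]; simp only [inv_zero, zero_mul]; positivity
    · rw [inv_mul_le_iff₀ h0]
      refine (norm_sub_le _ _).trans ?_
      linarith
  · filter_upwards [hg.contDiff] with t ht
    have h := ((ht.differentiable one_ne_zero) (e t x)).hasFDerivAt.comp x (e t).hasFDerivAt
    rw [hasFDerivAt_iff_tendsto] at h
    refine h.congr fun y => ?_
    rw [norm_smul, norm_inv, norm_norm]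
    rfl

/-- The operator norm of the difference of two derivatives is at most `|K|` times the `L²` norm of
the pointwise difference `φ y`, which tends to zero by dominated convergence. -/
theorem continuous_deriv [FiniteDimensional ℝ E] (hg : IsC1Caratheodory μ g k)
    (he : IsBoundedEval μ e K) : Continuous (deriv hg he) := by
  rw [continuous_iff_continuousAt]
  intro x
  set R := |K| * (‖x‖ + 1)
  have hball : ∀ᶠ y in 𝓝 x, ‖y - x‖ ≤ 1 := by
    filter_upwards [Metric.closedBall_mem_nhds x one_pos] with y hy
    simpa [dist_eq_norm] using hy
  have hxR : ∀ t, ‖e t x‖ ≤ R := he.norm_le_of_ball (by simp)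
  set φ : X → α → E →L[ℝ] F := fun y t => fderiv ℝ (g t) (e t y) - fderiv ℝ (g t) (e t x)
  have hbd : ∀ᶠ y in 𝓝 x, ∀ᵐ t ∂μ, ‖φ y t‖ ≤ 2 * ‖k R t‖ := by
    filter_upwards [hball] with y hy
    filter_upwards [hg.norm_fderiv_le] with t ht
    have h1 := ht R _ (he.norm_le_of_ball hy t)
    have h2 := ht R _ (hxR t)
    have h3 := le_abs_self (k R t)
    refine (norm_sub_le _ _).trans ?_
    rw [Real.norm_eq_abs]
    linarith
  have hmeas : ∀ y, AEStronglyMeasurable (φ y) μ := fun y =>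
    (hg.aestronglyMeasurable_fderiv (he.meas y)).sub (hg.aestronglyMeasurable_fderiv (he.meas x))
  have hdom : MemLp (fun t => 2 * ‖k R t‖) 2 μ := (hg.memLp R).norm.const_mul _
  have key := tendsto_eLpNorm_two_zero (μ := μ) (l := 𝓝 x) (φ := φ) hdom
    (Eventually.of_forall hmeas) hbd (by
      filter_upwards [hg.contDiff] with t ht
      have h1 : Continuous fun y => φ y t :=
        (((ht.continuous_fderiv one_ne_zero).comp (e t).continuous).sub continuous_const)
      have h2 := h1.norm.tendsto x
      simpa [φ] using h2)
  have key2 := (ENNReal.tendsto_toReal ENNReal.zero_ne_top).comp key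
  rw [ENNReal.toReal_zero] at key2
  have key3 := key2.const_mul |K|
  rw [mul_zero] at key3
  rw [ContinuousAt, tendsto_iff_norm_sub_tendsto_zero]
  refine squeeze_zero' (Eventually.of_forall fun y => norm_nonneg _) ?_ key3
  filter_upwards [hbd] with y hy
  refine ContinuousLinearMap.opNorm_le_bound _ (mul_nonneg (abs_nonneg _) ENNReal.toReal_nonneg) fun h => ?_
  have hmem : MemLp (φ y) 2 μ := hdom.mono' (hmeas y) hy
  have hle := toReal_eLpNorm_le (μ := μ)
    (φ := (deriv hg he y h - deriv hg he x h : Lp F 2 μ)) (ψ := φ y) (C := |K| * ‖h‖)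
    (by positivity) hmem (by
      filter_upwards [coeFn_deriv hg he y h, coeFn_deriv hg he x h,
        Lp.coeFn_sub (deriv hg he y h) (deriv hg he x h)] with t h1 h2 h3
      rw [h3, Pi.sub_apply, h1, h2, ← sub_apply, mul_comm]
      refine (ContinuousLinearMap.le_opNorm _ _).trans
        (mul_le_mul_of_nonneg_left ((he.norm_le t h).trans ?_) (norm_nonneg _))
      exact mul_le_mul_of_nonneg_right (le_abs_self _) (norm_nonneg _))
  rw [← Lp.norm_def] at hle
  rw [sub_apply, Function.comp_apply]
  linarith

theorem contDiff_operator [FiniteDimensional ℝ E] (hg : IsC1Caratheodory μ g k)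
    (he : IsBoundedEval μ e K) : ContDiff ℝ 1 (operator hg he) :=
  contDiff_one_iff_hasFDerivAt.2 ⟨deriv hg he, continuous_deriv hg he, hasFDerivAt_operator hg he⟩

end Nemytskii

namespace DirichletLaplace

variable {m : ℕ} {β : ℝ}

/-! ### Eigenvalues -/

theorem eigval_eq (β : ℝ) (j : ℕ) : eigval β j = ((j : ℝ) + 1) ^ (2 * β) := by
  rw [eigval, ← Real.rpow_natCast, ← Real.rpow_mul (by positivity)]
  norm_num

theorem one_le_eigval (hβ : 0 ≤ β) (j : ℕ) : 1 ≤ eigval β j := by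
  rw [eigval_eq]
  exact Real.one_le_rpow (by linarith [(Nat.cast_nonneg j : (0 : ℝ) ≤ j)]) (by linarith)

theorem summable_one_div_add_one_rpow {p : ℝ} (hp : 1 < p) :
    Summable fun j : ℕ => 1 / ((j : ℝ) + 1) ^ p := by
  have h := (summable_nat_add_iff 1).2 (Real.summable_one_div_nat_rpow.2 hp)
  simpa using h

theorem summable_inv_eigval (hβ : 1 / 2 < β) : Summable fun j => (eigval β j)⁻¹ := by
  simp_rw [eigval_eq, ← one_div]
  exact summable_one_div_add_one_rpow (by linarith)

theorem inv_eigval_sq (β : ℝ) (j : ℕ) : (eigval β j)⁻¹ ^ 2 = 1 / ((j : ℝ) + 1) ^ (4 * β) := by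
  rw [eigval_eq, inv_pow, ← Real.rpow_natCast, ← Real.rpow_mul (by positivity), one_div]
  congr 2
  push_cast; ring

theorem summable_inv_eigval_sq (hβ : 1 / 2 < β) : Summable fun j => (eigval β j)⁻¹ ^ 2 := by
  simp_rw [inv_eigval_sq]
  exact summable_one_div_add_one_rpow (by linarith)

theorem tsum_inv_eigval_sq (hβ : 1 / 2 < β) :
    ∑' j, (eigval β j)⁻¹ ^ 2 = (riemannZeta ((4 * β : ℝ) : ℂ)).re := by
  rw [zeta_eq_tsum_one_div_nat_add_one_cpow (by rw [Complex.ofReal_re]; linarith)]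
  have e : ∀ j : ℕ, 1 / ((j : ℂ) + 1) ^ ((4 * β : ℝ) : ℂ) = (((eigval β j)⁻¹ ^ 2 : ℝ) : ℂ) := by
    intro j
    rw [inv_eigval_sq, Complex.ofReal_div, Complex.ofReal_cpow (by positivity)]
    push_cast
    rfl
  simp_rw [e]
  rw [← Complex.ofReal_tsum, Complex.ofReal_re]

/-! ### Bessel's inequality -/

/-- The partial sum `p` satisfies `‖p‖² = ⟨p, y⟩`, so `0 ≤ ‖p - y‖² = ‖y‖² - ‖p‖²`. -/
theorem sum_norm_sq_sineCoeff_le (y : L2 m) (s : Finset ℕ) :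
    ∑ j ∈ s, ‖sineCoeff y j‖ ^ 2 ≤ ‖y‖ ^ 2 := by
  set p : L2 m := ∑ j ∈ s, sineModeₗᵢ m j (sineCoeff y j)
  have h1 : ‖p‖ ^ 2 = ∑ j ∈ s, ‖sineCoeff y j‖ ^ 2 :=
    (orthogonalFamily_sineMode m).norm_sum (sineCoeff y) s
  have h2 : inner ℝ p y = ∑ j ∈ s, ‖sineCoeff y j‖ ^ 2 := by
    rw [sum_inner]
    refine Finset.sum_congr rfl fun j _ => ?_
    exact (inner_sineMode_left j _ y).trans (real_inner_self_eq_norm_sq _)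
  have h3 := norm_sub_sq_real p y
  nlinarith [sq_nonneg ‖p - y‖]

theorem norm_sineCoeff_le (y : L2 m) (j : ℕ) : ‖sineCoeff y j‖ ≤ ‖y‖ := by
  have := sum_norm_sq_sineCoeff_le y {j}
  rw [Finset.sum_singleton] at this
  exact (sq_le_sq₀ (norm_nonneg _) (norm_nonneg _)).1 this

theorem norm_eigval_smul_sineCoeff_le (x : Dom m β) (j : ℕ) :
    eigval β j * ‖sineCoeff x.incl j‖ ≤ ‖x‖ := by
  have h := norm_sineCoeff_le (fracLaplacian m β x) j
  rwa [sineCoeff_fracLaplacian, norm_smul, Real.norm_of_nonneg (eigval_pos β j).le] at h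

theorem norm_sineCoeff_incl_le (x : Dom m β) (j : ℕ) :
    ‖sineCoeff x.incl j‖ ≤ ‖x‖ * (eigval β j)⁻¹ := by
  rw [← div_eq_mul_inv, le_div_iff₀ (eigval_pos β j), mul_comm]
  exact norm_eigval_smul_sineCoeff_le x j

/-- Each coefficient is at most `‖x‖ / j^(2β)` (with `j` counted from 1), and `2β > 1`. -/
theorem summable_norm_sineCoeff_incl (hβ : 1 / 2 < β) (x : Dom m β) :
    Summable fun j => ‖sineCoeff x.incl j‖ :=
  Summable.of_nonneg_of_le (fun _ => norm_nonneg _) (norm_sineCoeff_incl_le x)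
    ((summable_inv_eigval hβ).mul_left _)

/-- Cauchy–Schwarz for the inverse eigenvalues against the coefficients of `(-Δ)^β x`, then Bessel.
This is the source of `ζ(4β)` in the smallness condition. -/
theorem tsum_norm_sineCoeff_incl_le (hβ : 1 / 2 < β) (x : Dom m β) :
    ∑' j, ‖sineCoeff x.incl j‖ ≤ Real.sqrt (∑' j, (eigval β j)⁻¹ ^ 2) * ‖x‖ := by
  refine (summable_norm_sineCoeff_incl hβ x).tsum_le_of_sum_le fun s => ?_
  have h1 := Finset.sum_mul_sq_le_sq_mul_sq s (fun j => (eigval β j)⁻¹)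
    (fun j => ‖sineCoeff (fracLaplacian m β x) j‖)
  have h2 : ∀ j, (eigval β j)⁻¹ * ‖sineCoeff (fracLaplacian m β x) j‖ = ‖sineCoeff x.incl j‖ := by
    intro j
    rw [sineCoeff_fracLaplacian, norm_smul, Real.norm_of_nonneg (eigval_pos β j).le,
      inv_mul_cancel_left₀ (eigval_pos β j).ne']
  simp_rw [h2] at h1
  refine abs_le_of_sq_le_sq' ?_ (by positivity) |>.2
  rw [mul_pow, Real.sq_sqrt (tsum_nonneg fun j => by positivity)]
  refine h1.trans (mul_le_mul ?_ (sum_norm_sq_sineCoeff_le _ s)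
    (Finset.sum_nonneg fun j _ => by positivity) (tsum_nonneg fun j => by positivity))
  exact (summable_inv_eigval_sq hβ).sum_le_tsum s fun j _ => by positivity

/-! ### Point evaluation on the domain -/

/-- The embedding constant of `D((-Δ)^β)` into the bounded functions. -/
noncomputable def embConst (β : ℝ) : ℝ :=
  Real.sqrt (2 / Real.pi * (riemannZeta ((4 * β : ℝ) : ℂ)).re)

theorem embConst_nonneg (β : ℝ) : 0 ≤ embConst β := Real.sqrt_nonneg _

theorem embConst_eq (hβ : 1 / 2 < β) :
    embConst β = Real.sqrt (2 / Real.pi) * Real.sqrt (∑' j, (eigval β j)⁻¹ ^ 2) := by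
  rw [embConst, ← tsum_inv_eigval_sq hβ, Real.sqrt_mul (by positivity)]

theorem norm_sineFn_smul_le (j : ℕ) (t : ℝ) (c : Euc m) :
    ‖sineFn j t • c‖ ≤ Real.sqrt (2 / Real.pi) * ‖c‖ := by
  rw [norm_smul]
  exact mul_le_mul_of_nonneg_right (abs_sineFn_le j t) (norm_nonneg _)

theorem summable_norm_sineSeries (hβ : 1 / 2 < β) (t : ℝ) (x : Dom m β) :
    Summable fun j => ‖sineFn j t • sineCoeff x.incl j‖ :=
  Summable.of_nonneg_of_le (fun _ => norm_nonneg _) (fun j => norm_sineFn_smul_le j t _)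
    ((summable_norm_sineCoeff_incl hβ x).mul_left _)

theorem norm_sineSeries_le (hβ : 1 / 2 < β) (t : ℝ) (x : Dom m β) :
    ‖∑' j, sineFn j t • sineCoeff x.incl j‖
      ≤ Real.sqrt (2 / Real.pi) * ∑' j, ‖sineCoeff x.incl j‖ := by
  refine (norm_tsum_le_tsum_norm (summable_norm_sineSeries hβ t x)).trans ?_
  rw [← tsum_mul_left]
  exact (summable_norm_sineSeries hβ t x).tsum_le_tsum (fun j => norm_sineFn_smul_le j t _)
    ((summable_norm_sineCoeff_incl hβ x).mul_left _)

/-- Evaluation at `t` of the continuous representative of `x ∈ D((-Δ)^β)`. -/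
noncomputable def evalAt (m : ℕ) (hβ : 1 / 2 < β) (t : ℝ) : Dom m β →L[ℝ] Euc m :=
  LinearMap.mkContinuous
    { toFun := fun x => ∑' j, sineFn j t • sineCoeff x.incl j
      map_add' := fun x y => by
        simp_rw [map_add, sineCoeff_add, smul_add]
        exact (summable_norm_sineSeries hβ t x).of_norm.tsum_add
          (summable_norm_sineSeries hβ t y).of_norm
      map_smul' := fun c x => by
        simp_rw [map_smul, sineCoeff_smul, smul_comm _ c, RingHom.id_apply]
        exact (summable_norm_sineSeries hβ t x).of_norm.tsum_const_smul c }
    (embConst β) fun x => by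
      refine (norm_sineSeries_le hβ t x).trans ?_
      rw [embConst_eq hβ, mul_assoc]
      exact mul_le_mul_of_nonneg_left (tsum_norm_sineCoeff_incl_le hβ x) (Real.sqrt_nonneg _)

theorem evalAt_apply (hβ : 1 / 2 < β) (t : ℝ) (x : Dom m β) :
    evalAt m hβ t x = ∑' j, sineFn j t • sineCoeff x.incl j := rfl

theorem norm_evalAt_le (hβ : 1 / 2 < β) (t : ℝ) (x : Dom m β) :
    ‖evalAt m hβ t x‖ ≤ embConst β * ‖x‖ :=
  (evalAt m hβ t).le_of_opNorm_le
    (LinearMap.mkContinuous_norm_le _ (embConst_nonneg β) _) x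

theorem continuous_evalAt (hβ : 1 / 2 < β) (x : Dom m β) :
    Continuous fun t => evalAt m hβ t x := by
  simp_rw [evalAt_apply]
  exact continuous_tsum (fun j => (continuous_sineFn j).smul continuous_const)
    ((summable_norm_sineCoeff_incl hβ x).mul_left _) fun j t => norm_sineFn_smul_le j t _

/-- Integrating the series term by term against a sine shows that both functions have the same
coefficients; completeness of the sine system concludes. -/
theorem evalAt_ae_eq_incl (hβ : 1 / 2 < β) (x : Dom m β) :
    (fun t => evalAt m hβ t x) =ᵐ[leb] x.incl := by
  have hmem : MemLp (fun t => evalAt m hβ t x) 2 leb :=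
    MemLp.of_bound (continuous_evalAt hβ x).aestronglyMeasurable _
      (Eventually.of_forall fun t => norm_evalAt_le hβ t x)
  have key : hmem.toLp _ - x.incl = 0 := by
    refine eq_zero_of_sineCoeff_eq_zero _ fun i => ?_
    have hsub : sineCoeff (hmem.toLp _ - x.incl) i
        = sineCoeff (hmem.toLp _) i - sineCoeff x.incl i := by
      simp only [sineCoeff_eq_adjoint, map_sub]
    rw [hsub, sub_eq_zero]
    have h1 : sineCoeff (hmem.toLp _) i
        = ∫ t, ∑' j, (sineFn i t * sineFn j t) • sineCoeff x.incl j ∂leb := by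
      refine integral_congr_ae ?_
      filter_upwards [hmem.coeFn_toLp] with t ht
      rw [ht, evalAt_apply, ← (summable_norm_sineSeries hβ t x).of_norm.tsum_const_smul]
      simp_rw [smul_smul]
    have hmeas : ∀ j, Continuous fun t => (sineFn i t * sineFn j t) • sineCoeff x.incl j := fun j =>
      ((continuous_sineFn i).mul (continuous_sineFn j)).smul continuous_const
    have hbd : ∀ j t, ‖(sineFn i t * sineFn j t) • sineCoeff x.incl j‖
        ≤ Real.sqrt (2 / Real.pi) * (Real.sqrt (2 / Real.pi) * ‖sineCoeff x.incl j‖) := by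
      intro j t
      rw [← smul_smul]
      refine (norm_sineFn_smul_le i t _).trans ?_
      exact mul_le_mul_of_nonneg_left (norm_sineFn_smul_le j t _) (Real.sqrt_nonneg _)
    have hsum := ((summable_norm_sineCoeff_incl hβ x).mul_left
      (Real.sqrt (2 / Real.pi))).mul_left (Real.sqrt (2 / Real.pi))
    have h2 := hasSum_integral_of_dominated_convergence (μ := leb)
      (F := fun j t => (sineFn i t * sineFn j t) • sineCoeff x.incl j)
      (f := fun t => ∑' j, (sineFn i t * sineFn j t) • sineCoeff x.incl j)
      (fun j _ => Real.sqrt (2 / Real.pi) * (Real.sqrt (2 / Real.pi) * ‖sineCoeff x.incl j‖))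
      (fun j => (hmeas j).aestronglyMeasurable)
      (fun j => Eventually.of_forall (hbd j))
      (Eventually.of_forall fun t => hsum)
      (integrable_const _)
      (Eventually.of_forall fun t => (Summable.of_norm_bounded hsum fun j => hbd j t).hasSum)
    rw [h1]
    refine h2.unique ?_
    simp_rw [integral_smul_const, integral_sineFn_mul]
    refine (hasSum_ite_eq i (sineCoeff x.incl i)).congr_fun fun j => ?_
    by_cases hij : i = j
    · subst hij; simp
    · simp [hij, Ne.symm hij]
  rw [sub_eq_zero] at key
  exact hmem.coeFn_toLp.symm.trans (by rw [key])

theorem isBoundedEval_evalAt (hβ : 1 / 2 < β) :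
    Nemytskii.IsBoundedEval leb (evalAt m hβ) (embConst β) :=
  ⟨fun x => (continuous_evalAt hβ x).aestronglyMeasurable, norm_evalAt_le hβ⟩

/-! ### Completeness and compactness -/

/-- Dividing the coefficients of `y` by eigenvalues, all at least 1, keeps them square summable. -/
theorem fracLaplacian_surjective (hβ : 0 ≤ β) : Function.Surjective (fracLaplacian m β) := by
  intro y
  have hy : Summable fun j => ‖sineCoeff y j‖ ^ 2 :=
    summable_of_sum_le (fun j => by positivity) (sum_norm_sq_sineCoeff_le y)
  have hinv : ∀ j, ‖(eigval β j)⁻¹ • sineCoeff y j‖ ≤ ‖sineCoeff y j‖ := by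
    intro j
    rw [norm_smul, Real.norm_of_nonneg (inv_nonneg.2 (eigval_pos β j).le)]
    exact mul_le_of_le_one_left (norm_nonneg _) (inv_le_one_of_one_le₀ (one_le_eigval hβ j))
  have hsum : Summable fun j => sineModeₗᵢ m j ((eigval β j)⁻¹ • sineCoeff y j) := by
    rw [(orthogonalFamily_sineMode m).summable_iff_norm_sq_summable]
    exact Summable.of_nonneg_of_le (fun j => by positivity)
      (fun j => pow_le_pow_left₀ (norm_nonneg _) (hinv j) 2) hy
  obtain ⟨z, hz⟩ := hsum
  have hcoeff : ∀ i, sineCoeff z i = (eigval β i)⁻¹ • sineCoeff y i := by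
    intro i
    have h := hz.mapL (ContinuousLinearMap.adjoint (sineModeₗᵢ m i).toContinuousLinearMap)
    simp_rw [← sineCoeff_eq_adjoint] at h
    refine h.unique ((hasSum_ite_eq i ((eigval β i)⁻¹ • sineCoeff y i)).congr_fun fun j => ?_)
    refine (sineCoeff_sineMode i j _).trans ?_
    by_cases hij : i = j
    · subst hij; simp
    · simp [hij, Ne.symm hij]
  have hmul : ∀ i, eigval β i • sineCoeff z i = sineCoeff y i := fun i => by
    rw [hcoeff, smul_inv_smul₀ (eigval_pos β i).ne']
  have hzdom : z ∈ domain m β := by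
    change Summable fun j => ‖eigval β j • sineCoeff z j‖ ^ 2
    simpa only [hmul] using hy
  obtain ⟨w, hw⟩ : ∃ w : Dom m β, w.incl = z := ⟨(⟨z, hzdom⟩ : ↥(domain m β)), rfl⟩
  refine ⟨w, sub_eq_zero.1 (eq_zero_of_sineCoeff_eq_zero _ fun j => ?_)⟩
  rw [sineCoeff_eq_adjoint, map_sub, ← sineCoeff_eq_adjoint, ← sineCoeff_eq_adjoint,
    sineCoeff_fracLaplacian, hw, sub_eq_zero]
  exact hmul j

/-- The operator `(-Δ)^β` as a linear isometry. -/
noncomputable def fracLaplacianₗᵢ (m : ℕ) (β : ℝ) : Dom m β →ₗᵢ[ℝ] L2 m :=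
  ⟨fracLaplacian m β, fun _ => rfl⟩

theorem completeSpace_dom (hβ : 0 ≤ β) : CompleteSpace (Dom m β) :=
  (LinearIsometryEquiv.ofSurjective (fracLaplacianₗᵢ m β)
    (fracLaplacian_surjective hβ)).toIsometryEquiv.completeSpace

/-- The embedding of `D((-Δ)^β)` into the bounded functions is compact. -/
theorem exists_subseq_evalAt_cauchy (hβ : 1 / 2 < β) (x : ℕ → Dom m β) {R : ℝ}
    (hR : ∀ n, ‖x n‖ ≤ R) :
    ∃ (σ : ℕ → ℕ) (s : ℕ → ℝ), StrictMono σ ∧ Tendsto s atTop (𝓝 0) ∧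
      ∀ n l t, ‖evalAt m hβ t (x (σ n) - x (σ l))‖ ≤ s n + s l := by
  -- The coefficient sequences lie in a countable product of balls, compact by Tychonoff; a
  -- subsequence converges coordinatewise.
  have hK : IsCompact (Set.pi univ fun j : ℕ =>
      Metric.closedBall (0 : Euc m) (R * (eigval β j)⁻¹)) :=
    isCompact_univ_pi fun j => isCompact_closedBall _ _
  have hcR : ∀ n j, ‖sineCoeff (x n).incl j‖ ≤ R * (eigval β j)⁻¹ := fun n j =>
    (norm_sineCoeff_incl_le (x n) j).trans
      (mul_le_mul_of_nonneg_right (hR n) (inv_nonneg.2 (eigval_pos β j).le))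
  obtain ⟨c, hc, σ, hσ, hlim⟩ := hK.tendsto_subseq (x := fun n j => sineCoeff (x n).incl j)
    fun n j _ => by simpa using hcR n j
  have hcb : ∀ j, ‖c j‖ ≤ R * (eigval β j)⁻¹ := fun j => by simpa using hc j (mem_univ j)
  rw [tendsto_pi_nhds] at hlim
  have hbd : ∀ n j, ‖sineCoeff (x (σ n)).incl j - c j‖ ≤ 2 * R * (eigval β j)⁻¹ := fun n j => by
    refine (norm_sub_le _ _).trans ?_
    linarith [hcR (σ n) j, hcb j]
  have hsumm : Summable fun j => 2 * R * (eigval β j)⁻¹ := (summable_inv_eigval hβ).mul_left _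
  have hsum : ∀ n, Summable fun j => ‖sineCoeff (x (σ n)).incl j - c j‖ := fun n =>
    Summable.of_nonneg_of_le (fun _ => norm_nonneg _) (hbd n) hsumm
  -- `s n` is a multiple of the `ℓ¹` distance to the limit `c`, which tends to zero by domination
  -- with `2R` times the inverse eigenvalues. No element of the domain with coefficients `c` is
  -- needed.
  refine ⟨σ, fun n => Real.sqrt (2 / Real.pi) * ∑' j, ‖sineCoeff (x (σ n)).incl j - c j‖, hσ, ?_,
    fun n l t => ?_⟩
  · have h := tendsto_tsum_of_dominated_convergence (𝓕 := atTop)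
      (f := fun n j => ‖sineCoeff (x (σ n)).incl j - c j‖) (g := fun _ => 0) hsumm
      (fun j => by
        have := tendsto_iff_norm_sub_tendsto_zero.1 (hlim j)
        exact this)
      (Eventually.of_forall fun n j => by rw [norm_norm]; exact hbd n j)
    simpa using h.const_mul (Real.sqrt (2 / Real.pi))
  · refine (norm_sineSeries_le hβ t _).trans ?_
    rw [← mul_add, ← (hsum n).tsum_add (hsum l)]
    refine mul_le_mul_of_nonneg_left ?_ (Real.sqrt_nonneg _)
    refine (summable_norm_sineCoeff_incl hβ _).tsum_le_tsum (fun j => ?_) ((hsum n).add (hsum l))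
    have h : sineCoeff (x (σ n) - x (σ l)).incl j
        = (sineCoeff (x (σ n)).incl j - c j) - (sineCoeff (x (σ l)).incl j - c j) := by
      rw [map_sub, sineCoeff_eq_adjoint, map_sub, ← sineCoeff_eq_adjoint, ← sineCoeff_eq_adjoint]
      abel
    rw [h]
    exact norm_sub_le _ _

end DirichletLaplace

/-! ### The Palais–Smale argument -/

namespace DirichletLaplace

variable {m : ℕ} {β : ℝ}

/-- A sequence whose pairwise distances are controlled by a null sequence is Cauchy. -/
theorem cauchySeq_of_norm_sq_sub_le {X : Type*} [NormedAddCommGroup X] {y : ℕ → X} {θ : ℕ → ℝ}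
    (hθ : Tendsto θ atTop (𝓝 0)) (h : ∀ n l, ‖y n - y l‖ ^ 2 ≤ θ n + θ l) : CauchySeq y := by
  refine Metric.cauchySeq_iff.2 fun ε hε => ?_
  obtain ⟨n₀, hn₀⟩ := eventually_atTop.1 (hθ.eventually (gt_mem_nhds (by positivity : 0 < ε ^ 2 / 2)))
  refine ⟨n₀, fun n hn l hl => ?_⟩
  rw [dist_eq_norm]
  refine lt_of_pow_lt_pow_left₀ 2 hε.le ((h n l).trans_lt ?_)
  linarith [hn₀ n hn, hn₀ l hl]

section Residual

variable {g : ℝ → Euc m → Euc m} {k : ℝ → ℝ → ℝ}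

/-- The residual `(-Δ)^β x - g(·, x(·))` as an element of `L²`. -/
noncomputable def residualL2 (hβ : 1 / 2 < β) (hg : Nemytskii.IsC1Caratheodory leb g k)
    (x : Dom m β) : L2 m :=
  fracLaplacianₗᵢ m β x - Nemytskii.operator hg (isBoundedEval_evalAt hβ) x

theorem hasFDerivAt_residualL2 (hβ : 1 / 2 < β) (hg : Nemytskii.IsC1Caratheodory leb g k)
    (x : Dom m β) :
    HasFDerivAt (residualL2 hβ hg) ((fracLaplacianₗᵢ m β).toContinuousLinearMap
      - Nemytskii.deriv hg (isBoundedEval_evalAt hβ) x) x :=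
  (fracLaplacianₗᵢ m β).toContinuousLinearMap.hasFDerivAt.sub
    (Nemytskii.hasFDerivAt_operator hg _ x)

theorem contDiff_residualL2 (hβ : 1 / 2 < β) (hg : Nemytskii.IsC1Caratheodory leb g k) :
    ContDiff ℝ 1 (residualL2 hβ hg) :=
  (fracLaplacianₗᵢ m β).toContinuousLinearMap.contDiff.sub (Nemytskii.contDiff_operator hg _)

theorem fderiv_half_norm_sq_residualL2 (hβ : 1 / 2 < β)
    (hg : Nemytskii.IsC1Caratheodory leb g k) (x h : Dom m β) :
    fderiv ℝ (fun x => (1 / 2 : ℝ) * ‖residualL2 hβ hg x‖ ^ 2) x h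
      = inner ℝ (residualL2 hβ hg x) (fracLaplacianₗᵢ m β h
        - Nemytskii.deriv hg (isBoundedEval_evalAt hβ) x h) := by
  rw [((hasFDerivAt_residualL2 hβ hg x).norm_sq.const_mul (1 / 2 : ℝ)).fderiv, inner_sub_right]
  simp

/-- The Palais-Smale condition for the least squares functional of a superposition operator of
linear growth with a small coefficient. -/
theorem palaisSmale_half_norm_sq_residualL2 (hβ : 1 / 2 < β)
    (hg : Nemytskii.IsC1Caratheodory leb g k) {q C : ℝ} (hq : q < 1)
    (hgrowth : ∀ x : Dom m β,
      ‖Nemytskii.operator hg (isBoundedEval_evalAt hβ) x‖ ≤ q * ‖x‖ + C) :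
    PalaisSmale (fun x : Dom m β => (1 / 2 : ℝ) * ‖residualL2 hβ hg x‖ ^ 2) := by
  refine ⟨contDiff_const.mul ((contDiff_residualL2 hβ hg).norm_sq ℝ), ?_⟩
  rintro x ⟨M, hM⟩ hx
  have := completeSpace_dom (m := m) (β := β) (by linarith)
  set G := residualL2 hβ hg
  set he := isBoundedEval_evalAt (m := m) hβ
  set N := Nemytskii.operator hg he
  set A := fracLaplacianₗᵢ m β
  -- From `½‖G‖² ≤ M` and `2‖G‖ ≤ ‖G‖² + 1`.
  have hG : ∀ n, ‖G (x n)‖ ≤ M + 1 := fun n => by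
    have := (le_abs_self _).trans (hM n)
    nlinarith [sq_nonneg (‖G (x n)‖ - 1)]
  -- Solves `‖x‖ ≤ (M + 1) + q‖x‖ + C` for `‖x‖`.
  set R := (M + 1 + C) / (1 - q)
  have hR : ∀ n, ‖x n‖ ≤ R := fun n => by
    rw [le_div_iff₀ (by linarith)]
    have h1 : A (x n) = G (x n) + N (x n) := (sub_add_cancel _ _).symm
    have h2 := norm_add_le (G (x n)) (N (x n))
    rw [← h1, A.norm_map] at h2
    linarith [hG n, hgrowth (x n)]
  obtain ⟨σ, s, hσ, hs, hsub⟩ := exists_subseq_evalAt_cauchy hβ x hR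
  set p : ℕ → ℝ := fun n =>
    ‖fderiv ℝ (fun x : Dom m β => (1 / 2 : ℝ) * ‖G x‖ ^ 2) (x (σ n))‖
  have hp : Tendsto p atTop (𝓝 0) := by
    have h1 := (hx.comp hσ.tendsto_atTop).norm
    rwa [norm_zero] at h1
  set B := (eLpNorm (k (embConst β * R)) 2 leb).toReal
  have hB : 0 ≤ B := ENNReal.toReal_nonneg
  have hball : ∀ n t, ‖evalAt m hβ t (x n)‖ ≤ embConst β * R := fun n t =>
    (norm_evalAt_le hβ t _).trans (mul_le_mul_of_nonneg_left (hR n) (embConst_nonneg β))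
  have hcs : CauchySeq (x ∘ σ) := by
    -- In `θ`, the `p` term comes from `φ'`, the `(M + 1)` term from the two pairings of `G` with
    -- `N'`, and the last from the increment of `N`; `2R` bounds `‖d‖`.
    refine cauchySeq_of_norm_sq_sub_le
      (θ := fun n => 2 * R * p n + (2 * (M + 1) * B + 2 * R * B) * s n) ?_ fun n l => ?_
    · simpa using (hp.const_mul (2 * R)).add (hs.const_mul (2 * (M + 1) * B + 2 * R * B))
    simp only [Function.comp_apply]
    set d := x (σ n) - x (σ l)
    have hS : ∀ t, ‖evalAt m hβ t d‖ ≤ s n + s l := hsub n l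
    have hS0 : 0 ≤ s n + s l := (norm_nonneg _).trans (hS 0)
    have hd : ‖d‖ ≤ 2 * R := (norm_sub_le _ _).trans (by linarith [hR (σ n), hR (σ l)])
    have hM0 : 0 ≤ M + 1 := (norm_nonneg _).trans (hG 0)
    have hderiv : ∀ i, |inner ℝ (G (x i)) (Nemytskii.deriv hg he (x i) d)|
        ≤ (M + 1) * ((s n + s l) * B) := fun i =>
      (abs_real_inner_le_norm _ _).trans (mul_le_mul (hG i)
        (Nemytskii.norm_deriv_apply_le hg he (hball i) hS0 hS) (norm_nonneg _) hM0)
    have hN : |inner ℝ (N (x (σ n)) - N (x (σ l))) (A d)| ≤ (s n + s l) * B * (2 * R) := by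
      refine (abs_real_inner_le_norm _ _).trans (mul_le_mul
        (Nemytskii.norm_operator_sub_le hg he (hball _) (hball _) hS0 hS) ?_ (norm_nonneg _)
        (by positivity))
      rwa [A.norm_map]
    have hφ : ∀ i, |inner ℝ (G (x (σ i))) (A d - Nemytskii.deriv hg he (x (σ i)) d)|
        ≤ p i * (2 * R) := fun i => by
      rw [← fderiv_half_norm_sq_residualL2, ← Real.norm_eq_abs]
      exact (ContinuousLinearMap.le_opNorm _ _).trans
        (mul_le_mul_of_nonneg_left hd (norm_nonneg _))
    have hAd : A d = G (x (σ n)) - G (x (σ l)) + (N (x (σ n)) - N (x (σ l))) := by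
      have h1 : A d = A (x (σ n)) - A (x (σ l)) := map_sub A _ _
      rw [h1]
      change _ = (A _ - N _) - (A _ - N _) + _
      abel
    -- Only the first factor of `⟨A d, A d⟩` is expanded; the `N'` terms are added and subtracted so
    -- that `φ'` at both points appears.
    have hexp : ‖d‖ ^ 2 = inner ℝ (G (x (σ n))) (A d - Nemytskii.deriv hg he (x (σ n)) d)
        + inner ℝ (G (x (σ n))) (Nemytskii.deriv hg he (x (σ n)) d)
        - inner ℝ (G (x (σ l))) (A d - Nemytskii.deriv hg he (x (σ l)) d)
        - inner ℝ (G (x (σ l))) (Nemytskii.deriv hg he (x (σ l)) d)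
        + inner ℝ (N (x (σ n)) - N (x (σ l))) (A d) := by
      rw [← A.norm_map d, ← real_inner_self_eq_norm_sq]
      nth_rewrite 1 [hAd]
      rw [inner_add_left, inner_sub_left, inner_sub_right (G (x (σ n))),
        inner_sub_right (G (x (σ l)))]
      ring
    have e1 := (abs_le.1 (hφ n)).2
    have e2 := (abs_le.1 (hφ l)).1
    have e3 := (abs_le.1 (hderiv (σ n))).2
    have e4 := (abs_le.1 (hderiv (σ l))).1
    have e5 := (abs_le.1 hN).2
    rw [hexp]
    linarith
  obtain ⟨x₀, hx₀⟩ := cauchySeq_tendsto_of_complete hcs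
  exact ⟨x₀, σ, hσ, hx₀⟩

end Residual

/-! ### The right-hand side with a fixed control -/

/-- A continuous function is bounded on each bounded interval. -/
theorem exists_bound_of_continuous_nnreal {γ : ℝ≥0 → ℝ≥0} (hγ : Continuous γ) (R : ℝ) :
    ∃ C : ℝ, 0 ≤ C ∧ ∀ s : ℝ≥0, (s : ℝ) ≤ R → (γ s : ℝ) ≤ C := by
  obtain ⟨C, hC⟩ := (isCompact_Icc (a := (0 : ℝ≥0)) (b := R.toNNReal)).bddAbove_image hγ.continuousOn
  refine ⟨C, C.2, fun s hs => ?_⟩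
  exact_mod_cast hC (mem_image_of_mem γ ⟨zero_le, NNReal.le_toNNReal_of_coe_le hs⟩)

section Control

variable {r : ℕ} {f : ℝ → Euc m → Euc r → Euc m} {a b : ℝ → ℝ} {γ δ : ℝ≥0 → ℝ≥0}

theorem ae_norm_control_le (u : LInf r) : ∀ᵐ t ∂leb, ‖u t‖ ≤ ‖u‖ := by
  filter_upwards [ae_le_eLpNormEssSup (f := u) (μ := leb)] with t ht
  rw [Lp.norm_def, eLpNorm_exponent_top, ← toReal_enorm]
  refine ENNReal.toReal_mono ?_ ht
  have := (Lp.memLp u).eLpNorm_ne_top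
  rwa [eLpNorm_exponent_top] at this

/-- Needed because `a` and `b` are not assumed nonnegative. -/
theorem mul_le_mul_abs {c y z : ℝ} (hy : 0 ≤ y) (hyz : y ≤ z) : c * y ≤ z * |c| := by
  rw [mul_comm z]
  exact mul_le_mul (le_abs_self c) hyz hy (abs_nonneg c)

/-- The control is essentially bounded, so `δ(|u|) ≤ D` almost everywhere. In the dominating
function `|R|` serves `f` and `C R` serves `f_x`. -/
theorem isC1Caratheodory_control
    (hf_meas : ∀ (x : Euc m) (u : Euc r), AEMeasurable (fun t => f t x u) leb)
    (hf_C1 : ∀ t ∈ Ioo 0 Real.pi, ContDiff ℝ 1 (fun p : Euc m × Euc r => f t p.1 p.2))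
    (ha : MemLp a 2 leb) (hb : MemLp b 2 leb)
    (hf : ∀ t ∈ Ioo 0 Real.pi, ∀ (x : Euc m) (u : Euc r),
      ‖f t x u‖ ≤ a t * ‖x‖ + b t * δ ‖u‖₊)
    (hfx : ∀ t ∈ Ioo 0 Real.pi, ∀ (x : Euc m) (u : Euc r),
      ‖fderiv ℝ (fun y => f t y u) x‖ ≤ a t * γ ‖x‖₊ + b t * δ ‖u‖₊)
    (u : LInf r) {D : ℝ} (hD : ∀ s : ℝ≥0, (s : ℝ) ≤ ‖u‖ → (δ s : ℝ) ≤ D)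
    {C : ℝ → ℝ} (hC0 : ∀ R, 0 ≤ C R) (hC : ∀ R, ∀ s : ℝ≥0, (s : ℝ) ≤ R → (γ s : ℝ) ≤ C R) :
    Nemytskii.IsC1Caratheodory leb (fun t x => f t x (u t))
      (fun R t => (|R| + C R) * |a t| + D * |b t|) where
  meas x := by
    refine Nemytskii.aestronglyMeasurable_superposition (g := fun t v => f t x v)
      (fun v => (hf_meas x v).aestronglyMeasurable) ?_ (Lp.memLp u).aestronglyMeasurable
    filter_upwards [ae_restrict_mem measurableSet_Ioo] with t ht
    exact (hf_C1 t ht).continuous.comp (by fun_prop : Continuous fun v : Euc r => (x, v))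
  contDiff := by
    filter_upwards [ae_restrict_mem measurableSet_Ioo] with t ht
    exact (hf_C1 t ht).comp (contDiff_id.prodMk contDiff_const)
  memLp R := (ha.abs.const_mul _).add (hb.abs.const_mul _)
  norm_le := by
    filter_upwards [ae_restrict_mem measurableSet_Ioo, ae_norm_control_le u] with t ht hu R x hx
    refine (hf t ht x (u t)).trans (add_le_add (mul_le_mul_abs (norm_nonneg _) ?_)
      (mul_le_mul_abs (NNReal.coe_nonneg _) (hD _ hu)))
    linarith [le_abs_self R, hC0 R]
  norm_fderiv_le := by
    filter_upwards [ae_restrict_mem measurableSet_Ioo, ae_norm_control_le u] with t ht hu R x hx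
    refine (hfx t ht x (u t)).trans (add_le_add (mul_le_mul_abs (NNReal.coe_nonneg _) ?_)
      (mul_le_mul_abs (NNReal.coe_nonneg _) (hD _ hu)))
    linarith [abs_nonneg R, hC R ‖x‖₊ hx]

/-- The growth condition is used directly, since the dominating function `k` would not give the
sharp coefficient of `‖x‖` that the smallness condition controls. -/
theorem norm_operator_control_le (hβ : 1 / 2 < β) (ha : MemLp a 2 leb) (hb : MemLp b 2 leb)
    (hf : ∀ t ∈ Ioo 0 Real.pi, ∀ (x : Euc m) (u : Euc r),
      ‖f t x u‖ ≤ a t * ‖x‖ + b t * δ ‖u‖₊)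
    (u : LInf r) {D : ℝ} (hD0 : 0 ≤ D) (hD : ∀ s : ℝ≥0, (s : ℝ) ≤ ‖u‖ → (δ s : ℝ) ≤ D)
    {k : ℝ → ℝ → ℝ} (hg : Nemytskii.IsC1Caratheodory leb (fun t x => f t x (u t)) k)
    (x : Dom m β) :
    ‖Nemytskii.operator hg (isBoundedEval_evalAt hβ) x‖
      ≤ embConst β * (eLpNorm a 2 leb).toReal * ‖x‖ + D * (eLpNorm b 2 leb).toReal := by
  have hA : MemLp (fun t => embConst β * ‖x‖ * |a t|) 2 leb := ha.abs.const_mul _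
  have hB : MemLp (fun t => D * |b t|) 2 leb := hb.abs.const_mul _
  have hx0 : 0 ≤ embConst β * ‖x‖ := mul_nonneg (embConst_nonneg β) (norm_nonneg _)
  have h1 : (eLpNorm (fun t => embConst β * ‖x‖ * |a t|) 2 leb).toReal
      ≤ embConst β * ‖x‖ * (eLpNorm a 2 leb).toReal :=
    Nemytskii.toReal_eLpNorm_le hx0 ha (Eventually.of_forall fun t => by
      rw [norm_mul, Real.norm_of_nonneg hx0, norm_abs_eq_norm])
  have h2 : (eLpNorm (fun t => D * |b t|) 2 leb).toReal ≤ D * (eLpNorm b 2 leb).toReal :=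
    Nemytskii.toReal_eLpNorm_le hD0 hb (Eventually.of_forall fun t => by
      rw [norm_mul, Real.norm_of_nonneg hD0, norm_abs_eq_norm])
  have h3 : eLpNorm (Nemytskii.operator hg (isBoundedEval_evalAt hβ) x) 2 leb
      ≤ eLpNorm (fun t => embConst β * ‖x‖ * |a t|) 2 leb + eLpNorm (fun t => D * |b t|) 2 leb := by
    refine (eLpNorm_mono_ae_real ?_).trans
      (eLpNorm_add_le hA.aestronglyMeasurable hB.aestronglyMeasurable (by norm_num))
    filter_upwards [Nemytskii.coeFn_operator hg (isBoundedEval_evalAt hβ) x,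
      ae_restrict_mem measurableSet_Ioo, ae_norm_control_le u] with t h ht hu
    rw [h]
    exact (hf t ht _ (u t)).trans (add_le_add
      (mul_le_mul_abs (norm_nonneg _) (norm_evalAt_le hβ t x))
      (mul_le_mul_abs (NNReal.coe_nonneg _) (hD _ hu)))
  have h4 := ENNReal.toReal_mono
    (ENNReal.add_ne_top.2 ⟨hA.eLpNorm_ne_top, hB.eLpNorm_ne_top⟩) h3
  rw [ENNReal.toReal_add hA.eLpNorm_ne_top hB.eLpNorm_ne_top, ← Lp.norm_def] at h4
  linarith

/-- Passes from the `L²` representative of `x` to the continuous one. -/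
theorem residual_ae_eq (hβ : 1 / 2 < β) (u : LInf r) {k : ℝ → ℝ → ℝ}
    (hg : Nemytskii.IsC1Caratheodory leb (fun t x => f t x (u t)) k) (x : Dom m β) :
    residual f x u =ᵐ[leb] residualL2 hβ hg x := by
  filter_upwards [Nemytskii.coeFn_operator hg (isBoundedEval_evalAt hβ) x,
    evalAt_ae_eq_incl hβ x, Lp.coeFn_sub (fracLaplacianₗᵢ m β x)
      (Nemytskii.operator hg (isBoundedEval_evalAt hβ) x)] with t h1 h2 h3
  rw [residualL2, h3, Pi.sub_apply, h1, h2]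
  rfl

end Control

end DirichletLaplace

/-! ### The main theorem -/

theorem mainTheorem4 (m r : ℕ) (β : ℝ) (hβ : 1 / 2 < β)
    (f : ℝ → Euc m → Euc r → Euc m)
    (hf_meas : ∀ (x : Euc m) (u : Euc r), AEMeasurable (fun t => f t x u) leb)
    (hf_C1 : ∀ t ∈ Ioo 0 Real.pi, ContDiff ℝ 1 (fun p : Euc m × Euc r => f t p.1 p.2))
    (a b : ℝ → ℝ) (ha : MemLp a 2 leb) (hb : MemLp b 2 leb)
    (γ δ : ℝ≥0 → ℝ≥0) (hγ : Continuous γ) (hδ : Continuous δ)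
    (hf : ∀ t ∈ Ioo 0 Real.pi, ∀ (x : Euc m) (u : Euc r),
      ‖f t x u‖ ≤ a t * ‖x‖ + b t * δ ‖u‖₊)
    (hfx : ∀ t ∈ Ioo 0 Real.pi, ∀ (x : Euc m) (u : Euc r),
      ‖fderiv ℝ (fun y => f t y u) x‖ ≤ a t * γ ‖x‖₊ + b t * δ ‖u‖₊)
    (hsmall : Real.sqrt (2 / Real.pi * (riemannZeta ((4 * β : ℝ) : ℂ)).re)
      * (eLpNorm a 2 leb).toReal < 1)
    (u : LInf r) :
    (∀ x : Dom m β, MemLp (residual f x u) 2 leb) ∧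
      PalaisSmale (fun x : Dom m β => energy f u x) := by
  obtain ⟨D, hD0, hD⟩ := exists_bound_of_continuous_nnreal hδ ‖u‖
  choose C hC0 hC using exists_bound_of_continuous_nnreal hγ
  have hg := isC1Caratheodory_control hf_meas hf_C1 ha hb hf hfx u hD hC0 hC
  refine ⟨fun x => (memLp_congr_ae (residual_ae_eq hβ u hg x)).2 (Lp.memLp _), ?_⟩
  have e : (fun x : Dom m β => energy f u x)
      = fun x => (1 / 2 : ℝ) * ‖residualL2 hβ hg x‖ ^ 2 := by
    ext x
    rw [energy, eLpNorm_congr_ae (residual_ae_eq hβ u hg x), Lp.norm_def]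
  rw [e]
  -- Here `q` is `embConst β` times the norm of `a`, so `hsmall` is exactly `q < 1`.
  exact palaisSmale_half_norm_sq_residualL2 hβ hg hsmall
    (norm_operator_control_le hβ ha hb hf u hD0 hD hg)
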